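/- Let $d,T$ be positive integers and let $\mathbf L$ be the space of real block-lower triangular $dT\times dT$ matrices with blocks $L_{t,s}\in\mathbb R^{d\times d}$, $1\le s,t\le T$ ($L_{t,s}=0$ for $t<s$), with Frobenius norm $\|\cdot\|_{\rm F}$. Let $\mathbf O\subset\mathbf L$ be the group of block-diagonal matrices with orthogonal $d\times d$ diagonal blocks, and write $[L]=\{LO:O\in\mathbf O\}\in\mathbf L/_{\mathbf O}$. Let $G=(G_1,\dots,G_T)$ be independent standard Gaussian vectors in $\mathbb R^d$ with filtration $\mathcal G_t=\sigma(G_s:s\le t)$. For $L,M\in\mathbf L$ let $d_{\rm ABW}(L,M)=\mathcal{AW}_2(LG,MG)$ be the adapted Wasserstein distance of the filtered processes $LG$ and $MG$: its square is the infimum of $\mathbb E_\pi|X-Y|^2$ over all bicausal couplings $\pi$ of $X=LG$ and $Y=MG$, that is, all couplings of the two filtered probability spaces (both equipped with $(\mathcal G_t)_t$) such that under $\pi$, for every $t$, the terminal information of each process is independent of the time-$t$ information of the other given its own time-$t$ information. The same symbol denotes the quotient distance $d_{\rm ABW}(x,y)=\inf\{d_{\rm ABW}(A,B):[A]=x,\,[B]=y\}$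 on $\mathbf L/_{\mathbf O}$. For $L\in\mathbf L$ let $\Gamma([L])$ be the set of maps $\gamma:[0,1]\to\mathbf L/_{\mathbf O}$ with $\gamma(0)=[L]$ and $d_{\rm ABW}(\gamma(u),\gamma(v))=|u-v|\,d_{\rm ABW}(\gamma(0),\gamma(1))$ for all $u,v\in[0,1]$ (constant-speed geodesics starting from $[L]$). For $L,M\in\mathbf L$ let $\mathbf O^*(L,M)$ be the set of minimizers of $O\mapsto\|L-MO\|_{\rm F}$ over $\mathbf O$, and let $\mathbf V(L)=\{MP-L: M\in\mathbf L,\ P\in\mathbf O^*(L,M)\}$. Let $\mathbf V(L)/_{\mathbf O^*(L,L)}$ be the quotient of $\mathbf V(L)$ by the equivalence relation $V\sim W$ if and only if $V=WO$ for some $O\in\mathbf O^*(L,L)$. **Theorem.** For every $L\in\mathbf L$, the assignment sending the class of $V\in\mathbf V(L)$ to the curve $u\mapsto[L+uV]$, $u\in[0,1]$, is a well-defined bijection from $\mathbf V(L)/_{\mathbf O^*(L,L)}$ onto $\Gamma([L])$. In particular, for every $\gamma\in\Gamma([L])$ there is $V\in\mathbf V(L)$ with $\gamma(u)=[L+uV]$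 for all $u\in[0,1]$. Moreover, if $L$ is regular, that is, if the diagonal block $(L^\top L)_{t,t}$ is positive definite for every $t=1,\dots,T$, then this $V\in\mathbf V(L)$ is unique. -/

import Mathlib

open MeasureTheory ProbabilityTheory
open scoped ENNReal

/-! ### Filtered processes, bicausal couplings and the adapted Wasserstein distance -/

/-- An `ℝ^d`-valued process in discrete time (the `T` times are the elements of `Fin T`) on a
filtered standard Borel probability space, adapted to the filtration. -/
structure FilteredProcess (d T : ℕ) where
  /-- the sample space -/
  Ω : Type
  [measurableSpace : MeasurableSpace Ω]
  [standardBorel : StandardBorelSpace Ω]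
  /-- the probability measure -/
  P : Measure Ω
  [isProbability : IsProbabilityMeasure P]
  /-- the filtration -/
  ℱ : Filtration (Fin T) measurableSpace
  /-- the process -/
  X : Fin T → Ω → EuclideanSpace ℝ (Fin d)
  adapted : Adapted ℱ X

namespace FilteredProcess

attribute [instance] measurableSpace standardBorel isProbability

variable {d T : ℕ}

/-- The information available at time `t`. -/
abbrev past (𝔛 : FilteredProcess d T) (t : Fin T) : MeasurableSpace 𝔛.Ω := 𝔛.ℱ t

/-- The information available at the terminal time. -/
abbrev total (𝔛 : FilteredProcess d T) : MeasurableSpace 𝔛.Ω := ⨆ t, 𝔛.ℱ t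

/-- A probability measure `π` on the product of the sample spaces is a bicausal coupling of `𝔛`
and `𝔜` if it has the right marginals and, for every time `t`, under `π`, the terminal information
of `𝔛` is independent of the time-`t` information of `𝔜` given the time-`t` information of `𝔛`,
and vice versa. (σ-algebras on the factors are pulled back to the product; at the
last time the condition holds trivially.) -/
structure IsBicausal (𝔛 𝔜 : FilteredProcess d T) (π : ProbabilityMeasure (𝔛.Ω × 𝔜.Ω)) : Prop where
  fst_eq : (π : Measure (𝔛.Ω × 𝔜.Ω)).map Prod.fst = 𝔛.P
  snd_eq : (π : Measure (𝔛.Ω × 𝔜.Ω)).map Prod.snd = 𝔜.P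
  causal : ∀ t : Fin T,
    CondIndep ((𝔛.past t).comap Prod.fst) (𝔛.total.comap Prod.fst) ((𝔜.past t).comap Prod.snd)
      (MeasurableSpace.comap_le_iff_le_map.2
        (((𝔛.ℱ).le t).trans (MeasurableSpace.comap_le_iff_le_map.1 measurable_fst.comap_le)))
      (π : Measure (𝔛.Ω × 𝔜.Ω))
  anticausal : ∀ t : Fin T,
    CondIndep ((𝔜.past t).comap Prod.snd) (𝔜.total.comap Prod.snd) ((𝔛.past t).comap Prod.fst)
      (MeasurableSpace.comap_le_iff_le_map.2
        (((𝔜.ℱ).le t).trans (MeasurableSpace.comap_le_iff_le_map.1 measurable_snd.comap_le)))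
      (π : Measure (𝔛.Ω × 𝔜.Ω))

/-- The expected squared Euclidean distance of the two processes under `π`. -/
noncomputable def cost (𝔛 𝔜 : FilteredProcess d T) (π : ProbabilityMeasure (𝔛.Ω × 𝔜.Ω)) : ℝ≥0∞ :=
  ∫⁻ ω, ∑ t, ‖𝔛.X t ω.1 - 𝔜.X t ω.2‖ₑ ^ 2 ∂(π : Measure (𝔛.Ω × 𝔜.Ω))

/-- The adapted Wasserstein distance of order `2`. -/
noncomputable def adaptedW2 (𝔛 𝔜 : FilteredProcess d T) : ℝ≥0∞ :=
  (⨅ (π : ProbabilityMeasure (𝔛.Ω × 𝔜.Ω)) (_ : IsBicausal 𝔛 𝔜 π), cost 𝔛 𝔜 π) ^ (1 / 2 : ℝ)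

end FilteredProcess

namespace ABW

/-! ### Block-lower triangular matrices -/

/-- Square matrices consisting of `T × T` blocks of size `d × d`; the index `(i, t)` is coordinate
`i` of block `t`. -/
abbrev BlockMatrix (d T : ℕ) : Type := Matrix (Fin d × Fin T) (Fin d × Fin T) ℝ

/-- The algebra of block-lower triangular matrices: the blocks `(t, s)` with `t < s` vanish. -/
def blockLower (d T : ℕ) : Subalgebra ℝ (BlockMatrix d T) :=
  Matrix.blockTriangularSubalgebra (R := ℝ) ℝ
    (fun p : Fin d × Fin T => OrderDual.toDual p.2)

/-- The space `𝐋` of block-lower triangular matrices. -/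
abbrev BL (d T : ℕ) : Type := blockLower d T

/-- The block in position `(t, s)`. -/
def block {d T : ℕ} (A : BlockMatrix d T) (t s : Fin T) : Matrix (Fin d) (Fin d) ℝ :=
  A.submatrix (fun i => (i, t)) (fun i => (i, s))

section
attribute [local instance] Matrix.frobeniusNormedAddCommGroup

/-- The Frobenius norm. -/
noncomputable def frob {d T : ℕ} (A : BL d T) : ℝ := ‖(A : BlockMatrix d T)‖

end

variable {d T : ℕ}

/-! ### Gaussian processes and the adapted Bures-Wasserstein distance -/

/-- The value at time `t` of the process `L G`, as a function of `G = (G_1, …, G_T)`: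
`∑ s ≤ t, L_{t,s} G_s`. -/
noncomputable def linProcess (L : BL d T) (t : Fin T) (g : Fin T → EuclideanSpace ℝ (Fin d)) :
    EuclideanSpace ℝ (Fin d) :=
  ∑ s ∈ Finset.Iic t, Matrix.toEuclideanLin (block (L : BlockMatrix d T) t s) (g s)

/-- The process `L G`, where `G_1, …, G_T` are independent standard Gaussian vectors in `ℝ^d`
(realized as the coordinates of the canonical space), with the filtration
`𝒢_t = σ(G_s : s ≤ t)`. -/
noncomputable def gaussianProcess (L : BL d T) : FilteredProcess d T where
  Ω := Fin T → EuclideanSpace ℝ (Fin d)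
  P := Measure.pi fun _ => stdGaussian (EuclideanSpace ℝ (Fin d))
  ℱ := Filtration.natural (fun t g => g t) fun t => (measurable_pi_apply t).stronglyMeasurable
  X := linProcess L
  adapted := by
    intro t
    refine Finset.measurable_sum _ fun s hs => ?_
    refine (LinearMap.continuous_of_finiteDimensional _).measurable.comp ?_
    exact Measurable.mono (comap_measurable _)
      (le_iSup₂_of_le s (Finset.mem_Iic.1 hs) le_rfl) le_rfl

/-- The adapted Bures-Wasserstein distance on `𝐋`: the adapted Wasserstein distance of `L G` and
`M G`. -/
noncomputable def dABW (L M : BL d T) : ℝ :=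
  ((gaussianProcess L).adaptedW2 (gaussianProcess M)).toReal

/-! ### The quotient `𝐋 / 𝐎` -/

/-- The block-diagonal matrix with the given orthogonal diagonal blocks. -/
def orthDiag (O : Fin T → Matrix.orthogonalGroup (Fin d) ℝ) : BL d T :=
  ⟨Matrix.blockDiagonal fun t => (O t : Matrix (Fin d) (Fin d) ℝ), by
    rintro ⟨i, t⟩ ⟨j, s⟩ h
    have hts : t ≠ s := fun e => by subst e; exact lt_irrefl _ h
    simp [Matrix.blockDiagonal_apply, hts]⟩

/-- The set `𝐎` of block-diagonal matrices with orthogonal `d × d` diagonal blocks. -/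
def bO (d T : ℕ) : Set (BL d T) := Set.range orthDiag

theorem one_mem_bO : (1 : BL d T) ∈ bO d T :=
  ⟨1, Subtype.ext (Matrix.blockDiagonal_one (m := Fin d) (o := Fin T) (α := ℝ))⟩

theorem orthDiag_mul (o p : Fin T → Matrix.orthogonalGroup (Fin d) ℝ) :
    orthDiag (o * p) = orthDiag o * orthDiag p :=
  Subtype.ext (Matrix.blockDiagonal_mul (fun t => (o t : Matrix (Fin d) (Fin d) ℝ))
    (fun t => (p t : Matrix (Fin d) (Fin d) ℝ)))

theorem mul_mem_bO {O P : BL d T} (hO : O ∈ bO d T) (hP : P ∈ bO d T) : O * P ∈ bO d T := by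
  obtain ⟨o, rfl⟩ := hO
  obtain ⟨p, rfl⟩ := hP
  exact ⟨o * p, orthDiag_mul o p⟩

theorem exists_inv_bO {O : BL d T} (hO : O ∈ bO d T) : ∃ P ∈ bO d T, O * P = 1 := by
  obtain ⟨o, rfl⟩ := hO
  refine ⟨orthDiag o⁻¹, ⟨_, rfl⟩, ?_⟩
  rw [← orthDiag_mul, mul_inv_cancel]
  exact Subtype.ext (Matrix.blockDiagonal_one (m := Fin d) (o := Fin T) (α := ℝ))

/-- `L ∼ M` if and only if `L = M O` for some `O ∈ 𝐎`. -/
instance orthSetoid (d T : ℕ) : Setoid (BL d T) where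
  r L M := ∃ O ∈ bO d T, L = M * O
  iseqv :=
    { refl := fun L => ⟨1, one_mem_bO, (mul_one L).symm⟩
      symm := by
        rintro L M ⟨O, hO, rfl⟩
        obtain ⟨P, hP, h⟩ := exists_inv_bO hO
        exact ⟨P, hP, by rw [mul_assoc, h, mul_one]⟩
      trans := by
        rintro L M N ⟨O, hO, rfl⟩ ⟨P, hP, rfl⟩
        exact ⟨P * O, mul_mem_bO hP hO, mul_assoc _ _ _⟩ }

/-- The space `𝐋 / 𝐎`. -/
abbrev ABWSpace (d T : ℕ) : Type := Quotient (orthSetoid d T)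

/-- The class `[L]` of `L` in `𝐋 / 𝐎`. -/
def cls (L : BL d T) : ABWSpace d T := Quotient.mk _ L

/-- The quotient distance on `𝐋 / 𝐎` induced by `dABW`: the infimum over representatives. -/
noncomputable def qdist (x y : ABWSpace d T) : ℝ :=
  sInf {r : ℝ | ∃ A B : BL d T, cls A = x ∧ cls B = y ∧ dABW A B = r}

/-! ### Geodesics and the displacement directions -/

/-- `Γ([L])`: the constant speed geodesics in `𝐋 / 𝐎`, parametrized by `[0, 1]`, starting from
`[L]`. -/
def Geod (L : BL d T) : Set (unitInterval → ABWSpace d T) :=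
  {γ | γ 0 = cls L ∧
    ∀ u v : unitInterval, qdist (γ u) (γ v) = |(u : ℝ) - (v : ℝ)| * qdist (γ 0) (γ 1)}

/-- `𝐎*(L, M)`: the minimizers of `O ↦ ‖L - M O‖_F` over `𝐎`. -/
def Ostar (L M : BL d T) : Set (BL d T) :=
  {P | P ∈ bO d T ∧ ∀ O ∈ bO d T, frob (L - M * P) ≤ frob (L - M * O)}

/-- `𝐕(L) = {M P - L : M ∈ 𝐋, P ∈ 𝐎*(L, M)}`. -/
def VSet (L : BL d T) : Set (BL d T) :=
  {V | ∃ M : BL d T, ∃ P ∈ Ostar L M, V = M * P - L}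

theorem mem_Ostar_self {L O : BL d T} : O ∈ Ostar L L ↔ O ∈ bO d T ∧ L * O = L := by
  let _ := Matrix.frobeniusNormedAddCommGroup (m := Fin d × Fin T) (n := Fin d × Fin T) (α := ℝ)
  have h0 : frob (0 : BL d T) = 0 := norm_zero (E := BlockMatrix d T)
  refine ⟨fun h => ⟨h.1, ?_⟩, fun h => ⟨h.1, fun P _ => ?_⟩⟩
  · have h1 := h.2 1 one_mem_bO
    rw [mul_one, sub_self, h0] at h1
    have h2 : ((L - L * O : BL d T) : BlockMatrix d T) = 0 := norm_le_zero_iff.1 h1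
    exact (sub_eq_zero.1 (Subtype.ext h2 : L - L * O = 0)).symm
  · rw [h.2, sub_self, h0]
    exact norm_nonneg (E := BlockMatrix d T) _

/-- On `𝐕(L)`: `V ∼ W` if and only if `V = W O` for some `O ∈ 𝐎*(L, L)`. -/
def VSetoid (L : BL d T) : Setoid (VSet L) where
  r V W := ∃ O ∈ Ostar L L, (V : BL d T) = W * O
  iseqv :=
    { refl := fun V => ⟨1, mem_Ostar_self.2 ⟨one_mem_bO, mul_one L⟩, (mul_one _).symm⟩
      symm := by
        rintro V W ⟨O, hO, h⟩
        rw [mem_Ostar_self] at hO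
        obtain ⟨P, hP, hOP⟩ := exists_inv_bO hO.1
        refine ⟨P, mem_Ostar_self.2 ⟨hP, ?_⟩, by rw [h, mul_assoc, hOP, mul_one]⟩
        conv_lhs => rw [← hO.2]
        rw [mul_assoc, hOP, mul_one]
      trans := by
        rintro U V W ⟨O, hO, h⟩ ⟨P, hP, h'⟩
        rw [mem_Ostar_self] at hO hP
        refine ⟨P * O, mem_Ostar_self.2 ⟨mul_mem_bO hP.1 hO.1, ?_⟩, by rw [h, h', mul_assoc]⟩
        rw [← mul_assoc, hP.2, hO.2] }

/-- The quotient `𝐕(L) / 𝐎*(L, L)`. -/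
abbrev VQuot (L : BL d T) : Type := Quotient (VSetoid L)

/-- `L` is regular if every diagonal block of `Lᵀ L` is positive definite. -/
def IsReg (L : BL d T) : Prop :=
  ∀ t : Fin T,
    (block ((L : BlockMatrix d T).transpose * (L : BlockMatrix d T)) t t).PosDef

/-- The displacement interpolation `u ↦ [L + u V]`, `u ∈ [0, 1]`. -/
noncomputable def displacement (L V : BL d T) (u : unitInterval) : ABWSpace d T :=
  cls (L + (u : ℝ) • V)

end ABW

namespace ABW

open scoped Matrix

variable {d T : ℕ}

/-! The adapted distance is the orbit distance of a Euclidean space under a group of isometries: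
`dABW L M` is the minimum of `frob (L - M * O)` over `O ∈ bO d T`. Given a bicausal coupling of two
Gaussian paths X and Y, the cost depends only on the cross-covariance K = E[XYᵀ]; it equals ‖L‖² +
‖M‖² - 2 tr(LᵀMKᵀ). Bicausality makes K block-diagonal (`crossCov_transpose`), and its blocks are
contractions (`isContractive_crossCov`). A linear functional on such K is maximized by orthogonal
blocks, found from the polar decomposition of the diagonal blocks of LᵀM (`exists_optimal`). The
coupling of G with its rotation is bicausal and realizes them, whence `exists_mem_Ostar_dABW_eq`.

The rest is quotient geometry. A direction V lies in `VSet L` exactly when the segment from L to L +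
V is as long as the distance between the classes of its endpoints (`mem_VSet_iff`), and such
segments project to geodesics. Conversely, optimally aligned representatives along a geodesic
saturate the triangle inequality in Euclidean space, so they are collinear (`smul_sub_eq_smul_sub`).
Passing through the midpoint makes the lift rigid, which gives both surjectivity and injectivity
modulo the stabilizer `Ostar L L`; regularity of L makes that stabilizer trivial. -/

/-! ### Polar decomposition and trace maximization over contractions. -/

theorem exists_orthogonal_mul_posSemidef {n : Type*} [Fintype n] [DecidableEq n]
    (A : Matrix n n ℝ) : ∃ O ∈ Matrix.orthogonalGroup n ℝ, (A * O).PosSemidef := by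
  have hB : (A * A.transpose).PosSemidef := by
    simpa using Matrix.posSemidef_self_mul_conjTranspose A
  let E : Matrix n n ℝ := hB.isHermitian.eigenvectorUnitary
  have hE : E ∈ Matrix.orthogonalGroup n ℝ := hB.isHermitian.eigenvectorUnitary.2
  have hE1 : E * E.transpose = 1 := (Matrix.mem_orthogonalGroup_iff n ℝ).1 hE
  have hE2 : E.transpose * E = 1 := (Matrix.mem_orthogonalGroup_iff' n ℝ).1 hE
  let ev := hB.isHermitian.eigenvalues
  have hev : ∀ i, 0 ≤ ev i := hB.eigenvalues_nonneg
  have hspec : A * A.transpose = E * Matrix.diagonal ev * E.transpose := by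
    have := hB.isHermitian.spectral_theorem
    simpa [E, ev, Unitary.conjStarAlgAut_apply, Matrix.star_eq_conjTranspose,
      Function.comp_def] using this
  -- The columns of W are orthogonal with squared lengths `ev`. Normalizing the nonzero ones and
  -- completing them to an orthonormal basis gives a singular value decomposition of A, singular or
  -- not.
  let W : Matrix n n ℝ := A.transpose * E
  have hW : W.transpose * W = Matrix.diagonal ev := by
    have : W.transpose * W = E.transpose * (A * A.transpose) * E := by
      simp [W, Matrix.mul_assoc]
    rw [this, hspec]
    calc _ = (E.transpose * E) * Matrix.diagonal ev * (E.transpose * E) := by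
          simp only [Matrix.mul_assoc]
      _ = _ := by simp [hE2]
  let w : n → EuclideanSpace ℝ n := fun i => WithLp.toLp 2 fun j => W j i
  have hw : ∀ i j, inner ℝ (w i) (w j) = if i = j then ev i else 0 := by
    intro i j
    have := congrFun (congrFun hW i) j
    rw [Matrix.diagonal_apply] at this
    rw [← this]
    simp [w, Matrix.mul_apply, PiLp.inner_apply, mul_comm]
  let v : n → EuclideanSpace ℝ n := fun i => (√(ev i))⁻¹ • w i
  have hv : Orthonormal ℝ (({i | ev i ≠ 0} : Set n).domRestrict v) := by
    rw [orthonormal_iff_ite]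
    rintro ⟨i, hi⟩ ⟨j, hj⟩
    simp only [Set.domRestrict_apply, v, inner_smul_left, inner_smul_right, hw, Subtype.mk.injEq]
    split_ifs with h
    · subst h
      have h1 := Real.mul_self_sqrt (hev i)
      have h2 : √(ev i) ≠ 0 := fun h0 => hi (by rw [← h1, h0, zero_mul])
      simp only [conj_trivial]
      field_simp
      rw [sq, h1]
    · simp
  obtain ⟨b, hb⟩ := hv.exists_orthonormalBasis_extension_of_card_eq
    (by simp [finrank_euclideanSpace])
  have hwb : ∀ i, w i = √(ev i) • b i := by
    intro i
    by_cases hi : ev i = 0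
    · have : inner ℝ (w i) (w i) = 0 := by rw [hw, if_pos rfl, hi]
      rw [inner_self_eq_zero] at this
      simp [this, hi]
    · have h2 : √(ev i) ≠ 0 := by
        rw [Real.sqrt_ne_zero (hev i)]; exact hi
      rw [hb i hi]
      simp [v, smul_smul, h2]
  let B : Matrix n n ℝ := (EuclideanSpace.basisFun n ℝ).toBasis.toMatrix b
  have hB' : B ∈ Matrix.orthogonalGroup n ℝ :=
    (EuclideanSpace.basisFun n ℝ).toMatrix_orthonormalBasis_mem_unitary b
  have hB2 : B.transpose * B = 1 := (Matrix.mem_orthogonalGroup_iff' n ℝ).1 hB'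
  have hWB : W = B * Matrix.diagonal fun i => √(ev i) := by
    ext j i
    have := congrArg (fun x : EuclideanSpace ℝ n => x j) (hwb i)
    simp only [w, PiLp.smul_apply, smul_eq_mul] at this
    rw [Matrix.mul_diagonal, this, mul_comm]
    simp [B, Module.Basis.toMatrix_apply]
  have hA : A = E * Matrix.diagonal (fun i => √(ev i)) * B.transpose := by
    have h : A.transpose = W * E.transpose := by
      simp only [W, Matrix.mul_assoc, hE1, Matrix.mul_one]
    rw [← Matrix.transpose_transpose A, h, hWB]
    simp [Matrix.mul_assoc]
  refine ⟨B * E.transpose, mul_mem hB' (Unitary.star_mem hE), ?_⟩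
  have : A * (B * E.transpose) = E * Matrix.diagonal (fun i => √(ev i)) * E.conjTranspose := by
    conv_lhs => rw [hA]
    calc _ = E * Matrix.diagonal (fun i => √(ev i)) * (B.transpose * B) * E.transpose := by
          simp only [Matrix.mul_assoc]
      _ = _ := by simp [hB2]
  rw [this]
  exact (Matrix.PosSemidef.diagonal fun i => Real.sqrt_nonneg _).mul_mul_conjTranspose_same E

open scoped MatrixOrder Matrix.Norms.L2Operator in
-- Writing S = BᵀB turns both traces into sums over the rows b of B, of b · Kb and of b · b; the
-- hypothesis with both vectors equal to b compares them term by term.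
theorem trace_mul_transpose_le {n : Type*} [Fintype n] [DecidableEq n] {S K : Matrix n n ℝ}
    (hS : S.PosSemidef)
    (hK : ∀ a b : n → ℝ, 2 * a ⬝ᵥ (K *ᵥ b) ≤ a ⬝ᵥ a + b ⬝ᵥ b) :
    (S * K.transpose).trace ≤ S.trace := by
  obtain ⟨B, rfl⟩ := CStarAlgebra.nonneg_iff_eq_star_mul_self.1 hS.nonneg
  simp only [Matrix.star_eq_conjTranspose, Matrix.conjTranspose_eq_transpose_of_trivial]
  have h1 : (B.transpose * B * K.transpose).trace = ∑ k, B.row k ⬝ᵥ (K *ᵥ B.row k) := by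
    rw [Matrix.mul_assoc, Matrix.trace_mul_comm, ← Matrix.trace_transpose]
    simp [Matrix.trace, Matrix.mul_apply, dotProduct, Matrix.mulVec]
  have h2 : (B.transpose * B).trace = ∑ k, B.row k ⬝ᵥ B.row k := by
    rw [Matrix.trace_mul_comm]
    simp [Matrix.trace, Matrix.mul_apply, dotProduct]
  rw [h1, h2]
  refine Finset.sum_le_sum fun k _ => ?_
  have := hK (B.row k) (B.row k)
  linarith

theorem trace_mul_transpose_le_of_orthogonal {n : Type*} [Fintype n] [DecidableEq n]
    {A O K : Matrix n n ℝ} (hO : O ∈ Matrix.orthogonalGroup n ℝ) (hS : (A * O).PosSemidef)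
    (hK : ∀ a b : n → ℝ, 2 * a ⬝ᵥ (K *ᵥ b) ≤ a ⬝ᵥ a + b ⬝ᵥ b) :
    (A * K.transpose).trace ≤ (A * O).trace := by
  have hO1 : O * O.transpose = 1 := (Matrix.mem_orthogonalGroup_iff n ℝ).1 hO
  have hO2 : O.transpose * O = 1 := (Matrix.mem_orthogonalGroup_iff' n ℝ).1 hO
  have h := trace_mul_transpose_le (K := K * O) hS fun a b => by
    have hb : (O *ᵥ b) ⬝ᵥ (O *ᵥ b) = b ⬝ᵥ b := by
      rw [Matrix.dotProduct_mulVec, Matrix.vecMul_mulVec, ← Matrix.dotProduct_mulVec,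
        hO2, Matrix.one_mulVec]
    rw [← Matrix.mulVec_mulVec, ← hb]
    exact hK a _
  rwa [Matrix.transpose_mul, Matrix.mul_assoc, ← Matrix.mul_assoc O, hO1, Matrix.one_mul] at h

/-! ### The Frobenius norm and the optimal block rotation. -/

/-- The entries of a block-lower triangular matrix as a vector of a Euclidean space. -/
noncomputable def toEuc (d T : ℕ) :
    BL d T →ₗ[ℝ] EuclideanSpace ℝ ((Fin d × Fin T) × (Fin d × Fin T)) where
  toFun A := WithLp.toLp 2 fun x => (A : BlockMatrix d T) x.1 x.2
  map_add' A B := by ext x; simp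
  map_smul' c A := by ext x; simp

theorem toEuc_injective : Function.Injective (toEuc d T) := by
  intro A B h
  ext p q
  exact congrArg (fun x : EuclideanSpace ℝ ((Fin d × Fin T) × (Fin d × Fin T)) => x (p, q)) h

/-- Gives access to an inner product, on which the equality case of the triangle inequality rests.
-/
theorem norm_toEuc (A : BL d T) : ‖toEuc d T A‖ = frob A := by
  let _ := Matrix.frobeniusNormedAddCommGroup (m := Fin d × Fin T) (n := Fin d × Fin T) (α := ℝ)
  have h : frob A = (∑ i, ∑ j, ‖(A : BlockMatrix d T) i j‖ ^ (2 : ℝ)) ^ (1 / 2 : ℝ) :=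
    Matrix.frobenius_norm_def (A : BlockMatrix d T)
  rw [h, EuclideanSpace.norm_eq, Real.sqrt_eq_rpow, Fintype.sum_prod_type]
  simp [toEuc]

theorem frob_sq (A : BL d T) :
    frob A ^ 2 = ((A : BlockMatrix d T)ᵀ * (A : BlockMatrix d T)).trace := by
  rw [← norm_toEuc, EuclideanSpace.real_norm_sq_eq, Fintype.sum_prod_type, Finset.sum_comm]
  simp [toEuc, Matrix.trace, Matrix.mul_apply, sq]

theorem frob_nonneg (A : BL d T) : 0 ≤ frob A := norm_toEuc A ▸ norm_nonneg _

theorem frob_sub_comm (A B : BL d T) : frob (A - B) = frob (B - A) := by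
  simp only [← norm_toEuc, map_sub, norm_sub_rev]

theorem coe_orthDiag (o : Fin T → Matrix.orthogonalGroup (Fin d) ℝ) :
    (orthDiag o : BlockMatrix d T) = Matrix.blockDiagonal fun t => (o t).1 := rfl

theorem mul_transpose_of_mem_bO {O : BL d T} (hO : O ∈ bO d T) :
    (O : BlockMatrix d T) * (O : BlockMatrix d T)ᵀ = 1 := by
  obtain ⟨o, rfl⟩ := hO
  rw [coe_orthDiag, Matrix.blockDiagonal_transpose, ← Matrix.blockDiagonal_mul,
    ← Matrix.blockDiagonal_one]
  congr 1
  ext1 t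
  exact (Matrix.mem_orthogonalGroup_iff _ ℝ).1 (o t).2

theorem frob_mul_of_mem_bO (A : BL d T) {O : BL d T} (hO : O ∈ bO d T) :
    frob (A * O) = frob A := by
  rw [← sq_eq_sq₀ (frob_nonneg _) (frob_nonneg _), frob_sq, frob_sq]
  rw [Subalgebra.coe_mul, Matrix.transpose_mul, Matrix.mul_assoc, Matrix.trace_mul_comm,
    Matrix.mul_assoc, Matrix.mul_assoc, mul_transpose_of_mem_bO hO, Matrix.mul_one]

theorem frob_sub_sq (A B : BL d T) :
    frob (A - B) ^ 2 = frob A ^ 2 + frob B ^ 2 -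
      2 * ((A : BlockMatrix d T)ᵀ * (B : BlockMatrix d T)).trace := by
  simp only [frob_sq]
  have : ((B : BlockMatrix d T)ᵀ * (A : BlockMatrix d T)).trace =
      ((A : BlockMatrix d T)ᵀ * (B : BlockMatrix d T)).trace := by
    rw [← Matrix.trace_transpose]
    simp
  rw [show ((A - B : BL d T) : BlockMatrix d T) = (A : BlockMatrix d T) - B from rfl]
  simp only [Matrix.transpose_sub, sub_mul, mul_sub, Matrix.trace_sub, this]
  ring

theorem trace_mul_blockDiagonal (A : BlockMatrix d T)
    (n : Fin T → Matrix (Fin d) (Fin d) ℝ) :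
    (A * Matrix.blockDiagonal n).trace = ∑ t, (block A t t * n t).trace := by
  simp only [Matrix.trace, Matrix.diag, Matrix.mul_apply, Fintype.sum_prod_type_right, block,
    Matrix.submatrix_apply, Matrix.blockDiagonal_apply]
  refine Finset.sum_congr rfl fun t _ => Finset.sum_congr rfl fun i _ => ?_
  rw [Finset.sum_eq_single t (by simp +contextual) (by simp)]
  simp

/-- The bilinear form of `K` is bounded by one on the Euclidean unit ball. -/
def IsContractive {n : Type*} [Fintype n] (K : Matrix n n ℝ) : Prop :=
  ∀ a b : n → ℝ, 2 * a ⬝ᵥ (K *ᵥ b) ≤ a ⬝ᵥ a + b ⬝ᵥ b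

theorem isContractive_of_orthogonal {n : Type*} [Fintype n] [DecidableEq n] {O : Matrix n n ℝ}
    (hO : O ∈ Matrix.orthogonalGroup n ℝ) : IsContractive Oᵀ := by
  intro a b
  have hO1 : O * Oᵀ = 1 := (Matrix.mem_orthogonalGroup_iff n ℝ).1 hO
  have hb : (Oᵀ *ᵥ b) ⬝ᵥ (Oᵀ *ᵥ b) = b ⬝ᵥ b := by
    rw [Matrix.dotProduct_mulVec, Matrix.vecMul_mulVec, ← Matrix.dotProduct_mulVec,
      Matrix.transpose_transpose, hO1, Matrix.one_mulVec]
  rw [← hb]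
  have h : 0 ≤ (a - Oᵀ *ᵥ b) ⬝ᵥ (a - Oᵀ *ᵥ b) := by
    exact Finset.sum_nonneg fun i _ => mul_self_nonneg _
  rw [sub_dotProduct, dotProduct_sub, dotProduct_sub, dotProduct_comm (Oᵀ *ᵥ b) a] at h
  linarith

/-- The optimal rotation dominates all block-diagonal contractions. -/
theorem exists_optimal (L M : BL d T) : ∃ P ∈ bO d T,
    ∀ k : Fin T → Matrix (Fin d) (Fin d) ℝ, (∀ t, IsContractive (k t)) →
      ((L : BlockMatrix d T)ᵀ * (M * Matrix.blockDiagonal fun t => (k t)ᵀ)).trace ≤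
        ((L : BlockMatrix d T)ᵀ * ((M * P : BL d T) : BlockMatrix d T)).trace := by
  choose o ho hS using fun t =>
    exists_orthogonal_mul_posSemidef (block ((L : BlockMatrix d T)ᵀ * (M : BlockMatrix d T)) t t)
  refine ⟨orthDiag fun t => ⟨o t, ho t⟩, ⟨_, rfl⟩, fun k hk => ?_⟩
  rw [Subalgebra.coe_mul, coe_orthDiag, ← Matrix.mul_assoc, ← Matrix.mul_assoc,
    trace_mul_blockDiagonal, trace_mul_blockDiagonal]
  exact Finset.sum_le_sum fun t _ =>
    trace_mul_transpose_le_of_orthogonal (ho t) (hS t) (hk t)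

theorem frob_sub_mul_le {L M P Q : BL d T} (hP : P ∈ bO d T) (hQ : Q ∈ bO d T)
    (h : ((L : BlockMatrix d T)ᵀ * ((M * Q : BL d T) : BlockMatrix d T)).trace ≤
        ((L : BlockMatrix d T)ᵀ * ((M * P : BL d T) : BlockMatrix d T)).trace) :
    frob (L - M * P) ≤ frob (L - M * Q) := by
  rw [← sq_le_sq₀ (frob_nonneg _) (frob_nonneg _), frob_sub_sq, frob_sub_sq,
    frob_mul_of_mem_bO _ hP, frob_mul_of_mem_bO _ hQ]
  linarith

theorem mem_Ostar_of_optimal {L M P : BL d T} (hP : P ∈ bO d T)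
    (h : ∀ k : Fin T → Matrix (Fin d) (Fin d) ℝ, (∀ t, IsContractive (k t)) →
      ((L : BlockMatrix d T)ᵀ * (M * Matrix.blockDiagonal fun t => (k t)ᵀ)).trace ≤
        ((L : BlockMatrix d T)ᵀ * ((M * P : BL d T) : BlockMatrix d T)).trace) :
    P ∈ Ostar L M := by
  refine ⟨hP, fun Q hQ => frob_sub_mul_le hP hQ ?_⟩
  obtain ⟨q, rfl⟩ := hQ
  have := h (fun t => (q t).1ᵀ) fun t => isContractive_of_orthogonal (q t).2
  simpa only [Matrix.transpose_transpose, Subalgebra.coe_mul, coe_orthDiag] using this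

/-! ### Conditional independence. -/

/-- For A in `m₃` the conditional probability given `m'` is the constant P(A), so the factorization
P(A ∩ B | m') = P(A) P(B | m') integrates to independence. -/
theorem indep_of_condIndep {Ω : Type*} {m' m₁ m₂ m₃ : MeasurableSpace Ω} {mΩ : MeasurableSpace Ω}
    [StandardBorelSpace Ω] {μ : Measure Ω} [IsProbabilityMeasure μ] (hm' : m' ≤ mΩ)
    (hm₁ : m₁ ≤ mΩ) (hm₂ : m₂ ≤ mΩ) (hci : CondIndep m' m₁ m₂ hm' μ) (h31 : m₃ ≤ m₁)
    (hind : Indep m₃ m' μ) : Indep m₃ m₂ μ := by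
  rw [Indep_iff]
  intro A B hA hB
  have hA' : MeasurableSet A := hm₁ A (h31 A hA)
  have hB' : MeasurableSet B := hm₂ B hB
  have h1 := (condIndep_iff m' m₁ m₂ hm' hm₁ hm₂ μ).1 hci A B (h31 A hA) hB
  have h2 : μ⟦A|m'⟧ =ᵐ[μ] fun _ => μ.real A := by
    have := condExp_indep_eq (μ := μ) (f := A.indicator fun _ => (1 : ℝ)) (h31.trans hm₁) hm'
      ((stronglyMeasurable_const).indicator hA) hind
    filter_upwards [this] with x hx
    rw [hx, integral_indicator_const _ hA']
    simp
  have h3 : μ.real (A ∩ B) = μ.real A * μ.real B := by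
    calc μ.real (A ∩ B) = ∫ x, (A ∩ B).indicator (fun _ => (1 : ℝ)) x ∂μ := by
          rw [integral_indicator_const _ (hA'.inter hB')]; simp
      _ = ∫ x, (μ⟦A ∩ B|m'⟧) x ∂μ := (integral_condExp hm').symm
      _ = ∫ x, μ.real A * (μ⟦B|m'⟧) x ∂μ := by
          refine integral_congr_ae ?_
          filter_upwards [h1, h2] with x hx1 hx2
          rw [hx1, Pi.mul_apply, hx2]
      _ = μ.real A * μ.real B := by
          rw [integral_const_mul, integral_condExp hm', integral_indicator_const _ hB']; simp
  rw [← ENNReal.toReal_eq_toReal_iff' (measure_ne_top _ _)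
    (ENNReal.mul_ne_top (measure_ne_top _ _) (measure_ne_top _ _)), ENNReal.toReal_mul]
  exact h3

/-- Given `m'`, the events of `m₂` are deterministic up to null sets, and their indicators can be
pulled out of the conditional expectation. -/
theorem condIndep_of_forall_ae_eq {Ω : Type*} {m' m₁ m₂ : MeasurableSpace Ω}
    {mΩ : MeasurableSpace Ω}
    [StandardBorelSpace Ω] {μ : Measure Ω} [IsProbabilityMeasure μ] (hm' : m' ≤ mΩ)
    (hm₁ : m₁ ≤ mΩ) (hm₂ : m₂ ≤ mΩ)
    (h : ∀ B, MeasurableSet[m₂] B → ∃ C, MeasurableSet[m'] C ∧ B =ᵐ[μ] C) :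
    CondIndep m' m₁ m₂ hm' μ := by
  rw [condIndep_iff m' m₁ m₂ hm' hm₁ hm₂ μ]
  intro A B hA hB
  obtain ⟨C, hC, hBC⟩ := h B hB
  have hA' : MeasurableSet A := hm₁ A hA
  have e1 : (A ∩ B).indicator (fun _ => (1 : ℝ)) =ᵐ[μ]
      C.indicator (A.indicator fun _ => (1 : ℝ)) := by
    filter_upwards [hBC.mem_iff] with x hx
    by_cases h1 : x ∈ A <;> by_cases h2 : x ∈ C <;> simp [Set.indicator, h1, h2, hx]
  have e2 : B.indicator (fun _ => (1 : ℝ)) =ᵐ[μ] C.indicator fun _ => (1 : ℝ) := by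
    filter_upwards [hBC.mem_iff] with x hx
    by_cases h2 : x ∈ C <;> simp [Set.indicator, h2, hx]
  have e3 : μ[C.indicator fun _ => (1 : ℝ)|m'] = C.indicator fun _ => (1 : ℝ) :=
    condExp_of_stronglyMeasurable hm' (stronglyMeasurable_const.indicator hC)
      ((integrable_const _).indicator (hm' C hC))
  filter_upwards [condExp_congr_ae (m := m') e1, condExp_congr_ae (m := m') e2,
    condExp_indicator ((integrable_const (μ := μ) (1 : ℝ)).indicator hA') hC] with x h1 h2 h3
  rw [h1, h3, Pi.mul_apply, h2, e3]
  by_cases hx : x ∈ C <;> simp [hx]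

/-! ### Second moments and filtration of the Gaussian path. -/

theorem integral_sq_sum {Ω ι : Type*} [Fintype ι] {mΩ : MeasurableSpace Ω} {μ : Measure Ω}
    {Z : ι → Ω → ℝ} (hZ : ∀ i, MemLp (Z i) 2 μ) (c : ι → ℝ) :
    ∫ ω, (∑ i, c i * Z i ω) ^ 2 ∂μ = ∑ i, ∑ j, c i * c j * ∫ ω, Z i ω * Z j ω ∂μ := by
  have hint : ∀ i j, Integrable (fun ω => Z i ω * Z j ω) μ := fun i j =>
    (hZ i).integrable_mul (hZ j)
  have : ∀ ω, (∑ i, c i * Z i ω) ^ 2 = ∑ i, ∑ j, c i * c j * (Z i ω * Z j ω) := by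
    intro ω
    rw [sq, Finset.sum_mul_sum]
    exact Finset.sum_congr rfl fun i _ => Finset.sum_congr rfl fun j _ => by ring
  simp_rw [this]
  rw [integral_finsetSum _ fun i _ => integrable_finsetSum _ fun j _ => (hint i j).const_mul _]
  refine Finset.sum_congr rfl fun i _ => ?_
  rw [integral_finsetSum _ fun j _ => (hint i j).const_mul _]
  exact Finset.sum_congr rfl fun j _ => integral_const_mul _ _

/-- The canonical Gaussian measure on paths. -/
noncomputable abbrev gaussianPath (d T : ℕ) : Measure (Fin T → EuclideanSpace ℝ (Fin d)) :=
  Measure.pi fun _ => stdGaussian (EuclideanSpace ℝ (Fin d))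

theorem memLp_coord (q : Fin d × Fin T) :
    MemLp (fun g : Fin T → EuclideanSpace ℝ (Fin d) => g q.2 q.1) 2 (gaussianPath d T) := by
  have h : MemLp (fun x : EuclideanSpace ℝ (Fin d) => x q.1) 2
      (stdGaussian (EuclideanSpace ℝ (Fin d))) :=
    IsGaussian.memLp_dual _ (EuclideanSpace.proj q.1 : StrongDual ℝ _) 2 (by simp)
  exact h.comp_measurePreserving (measurePreserving_eval _ q.2)

theorem measurable_coord (q : Fin d × Fin T) :
    Measurable fun g : Fin T → EuclideanSpace ℝ (Fin d) => g q.2 q.1 :=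
  (EuclideanSpace.proj q.1 : StrongDual ℝ (EuclideanSpace ℝ (Fin d))).continuous.measurable.comp
    (measurable_pi_apply q.2)

theorem integral_proj_stdGaussian (i : Fin d) :
    ∫ x : EuclideanSpace ℝ (Fin d), x i ∂stdGaussian (EuclideanSpace ℝ (Fin d)) = 0 :=
  integral_strongDual_stdGaussian (EuclideanSpace.proj i : StrongDual ℝ _)

theorem integral_coord (q : Fin d × Fin T) :
    ∫ g : Fin T → EuclideanSpace ℝ (Fin d), g q.2 q.1 ∂(gaussianPath d T) = 0 := by
  rw [← integral_proj_stdGaussian q.1]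
  exact integral_comp_eval (μ := fun _ : Fin T => stdGaussian (EuclideanSpace ℝ (Fin d)))
    (f := fun x => x q.1) (by fun_prop)

theorem integral_proj_mul_proj (i j : Fin d) :
    ∫ x : EuclideanSpace ℝ (Fin d), x i * x j ∂stdGaussian (EuclideanSpace ℝ (Fin d)) =
      if i = j then 1 else 0 := by
  have h := covarianceBilin_apply (μ := stdGaussian (EuclideanSpace ℝ (Fin d)))
    IsGaussian.memLp_two_id (EuclideanSpace.basisFun (Fin d) ℝ i)
    (EuclideanSpace.basisFun (Fin d) ℝ j)
  simp only [id, integral_id_stdGaussian] at h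
  rw [covarianceBilin_stdGaussian, innerSL_apply_apply,
    orthonormal_iff_ite.1 (EuclideanSpace.basisFun (Fin d) ℝ).orthonormal] at h
  rw [h]
  simp [EuclideanSpace.inner_single_left]

theorem integral_coord_mul_coord (q r : Fin d × Fin T) :
    ∫ g : Fin T → EuclideanSpace ℝ (Fin d), g q.2 q.1 * g r.2 r.1 ∂(gaussianPath d T) =
      if q = r then 1 else 0 := by
  obtain ⟨i, t⟩ := q
  obtain ⟨j, s⟩ := r
  by_cases hts : t = s
  · subst hts
    simp only [Prod.mk.injEq, and_true]
    rw [← integral_proj_mul_proj i j]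
    exact integral_comp_eval (μ := fun _ : Fin T => stdGaussian (EuclideanSpace ℝ (Fin d)))
      (f := fun x => x i * x j) (by fun_prop)
  · have hind := (iIndepFun_pi (μ := fun _ : Fin T => stdGaussian (EuclideanSpace ℝ (Fin d)))
      (X := fun _ => id) fun _ => aemeasurable_id).indepFun hts
    have hind' := hind.comp (φ := fun x => x i) (ψ := fun x => x j) (by fun_prop) (by fun_prop)
    rw [if_neg (by simp [hts])]
    have h := hind'.integral_fun_mul_eq_mul_integral
      (memLp_coord (T := T) (i, t)).aestronglyMeasurable
      (memLp_coord (T := T) (j, s)).aestronglyMeasurable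
    have h0 := integral_coord (d := d) (i, t)
    simp only [Function.comp_apply, id] at h h0
    rw [h, h0, zero_mul]

/-- The filtration generated by the canonical process. -/
def pathFiltration (d T : ℕ) : Filtration (Fin T)
    (inferInstance : MeasurableSpace (Fin T → EuclideanSpace ℝ (Fin d))) :=
  Filtration.natural (fun t g => g t) fun t => (measurable_pi_apply t).stronglyMeasurable

theorem pathFiltration_apply (t : Fin T) : pathFiltration d T t =
    ⨆ s ∈ Set.Iic t, MeasurableSpace.comap (fun g : Fin T → EuclideanSpace ℝ (Fin d) => g s)
      inferInstance := rfl

theorem indep_pathFiltration {s s' : Fin T} (h : s < s') :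
    Indep (MeasurableSpace.comap (fun g : Fin T → EuclideanSpace ℝ (Fin d) => g s')
      inferInstance) (pathFiltration d T s) (gaussianPath d T) := by
  have hind := iIndepFun_pi (μ := fun _ : Fin T => stdGaussian (EuclideanSpace ℝ (Fin d)))
      (X := fun _ => id) fun _ => aemeasurable_id
  have := indep_iSup_of_disjoint (S := {s'}) (T := Set.Iic s)
    (fun i => (measurable_pi_apply i).comap_le) hind (by simpa using h)
  rw [iSup_singleton] at this
  exact this

theorem comap_le_pathFiltration (s : Fin T) :
    MeasurableSpace.comap (fun g : Fin T → EuclideanSpace ℝ (Fin d) => g s) inferInstance ≤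
      pathFiltration d T s :=
  le_iSup₂_of_le (f := fun r (_ : r ∈ Set.Iic s) => MeasurableSpace.comap
    (fun g : Fin T → EuclideanSpace ℝ (Fin d) => g r) inferInstance) s (Set.mem_Iic.2 le_rfl)
      le_rfl

theorem indep_comap_of_indep_map {Ω E : Type*} {m₁ m₂ mE : MeasurableSpace E}
    {mΩ : MeasurableSpace Ω} {μ : Measure Ω} {Y : Ω → E} (hY : Measurable Y) (h₁ : m₁ ≤ mE)
    (h₂ : m₂ ≤ mE) (h : Indep m₁ m₂ (μ.map Y)) :
    Indep (m₁.comap Y) (m₂.comap Y) μ := by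
  rw [Indep_iff] at h ⊢
  rintro _ _ ⟨A, hA, rfl⟩ ⟨B, hB, rfl⟩
  have := h A B hA hB
  rwa [Measure.map_apply hY ((h₁ A hA).inter (h₂ B hB)), Measure.map_apply hY (h₁ A hA),
    Measure.map_apply hY (h₂ B hB)] at this

/-- Under a causal coupling, the past of `X` is uncorrelated with the later values of `Y`. -/
theorem integral_coord_mul_coord_eq_zero {Ω : Type*} {mΩ : MeasurableSpace Ω}
    [StandardBorelSpace Ω] {μ : Measure Ω} [IsProbabilityMeasure μ]
    {X Y : Ω → Fin T → EuclideanSpace ℝ (Fin d)} (hX : Measurable X) (hY : Measurable Y)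
    (hYμ : μ.map Y = gaussianPath d T) {s s' : Fin T}
    (h : s < s') (hm : (pathFiltration d T s).comap Y ≤ mΩ)
    (hci : CondIndep ((pathFiltration d T s).comap Y) ((⨆ t, pathFiltration d T t).comap Y)
      ((pathFiltration d T s).comap X) hm μ) (i j : Fin d) :
    ∫ ω, X ω s i * Y ω s' j ∂μ = 0 := by
  have hle : ∀ t, pathFiltration d T t ≤ MeasurableSpace.pi := (pathFiltration d T).le
  -- The value of Y at s' belongs to its terminal information and is independent of its past up to
  -- s, so conditional independence upgrades to independence from the past of X.
  have hind : Indep ((MeasurableSpace.comap (fun g : Fin T → EuclideanSpace ℝ (Fin d) => g s')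
      inferInstance).comap Y) ((pathFiltration d T s).comap X) μ := by
    refine indep_of_condIndep hm
      ((MeasurableSpace.comap_mono (iSup_le hle)).trans hY.comap_le)
      ((MeasurableSpace.comap_mono (hle s)).trans hX.comap_le) hci
      (MeasurableSpace.comap_mono
        ((comap_le_pathFiltration s').trans (le_iSup (pathFiltration d T) s'))) ?_
    refine indep_comap_of_indep_map hY (measurable_pi_apply s').comap_le (hle s) ?_
    rw [hYμ]
    exact indep_pathFiltration h
  have hind2 : IndepFun (fun ω => Y ω s') (fun ω => X ω s) μ := by
    rw [IndepFun_iff_Indep]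
    rw [MeasurableSpace.comap_comp] at hind
    refine indep_of_indep_of_le_right hind ?_
    have hle' := MeasurableSpace.comap_mono (g := X) (comap_le_pathFiltration (d := d) s)
    rwa [MeasurableSpace.comap_comp] at hle'
  have hind3 := hind2.comp (φ := fun x => x j) (ψ := fun x => x i) (by fun_prop) (by fun_prop)
  have h0 : ∫ ω, Y ω s' j ∂μ = 0 := by
    have := integral_coord (d := d) (T := T) (j, s')
    rwa [← hYμ, integral_map hY.aemeasurable (measurable_coord (j, s')).aestronglyMeasurable]
      at this
  have hp := hind3.integral_fun_mul_eq_mul_integral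
    ((measurable_coord (j, s')).comp hY).aestronglyMeasurable
    ((measurable_coord (i, s)).comp hX).aestronglyMeasurable
  simp only [Function.comp_apply] at hp
  simp_rw [mul_comm (X _ s i)]
  rw [hp, h0, zero_mul]

/-! ### Cross-covariance and transport cost. -/

theorem linProcess_apply (L : BL d T) (t : Fin T) (g : Fin T → EuclideanSpace ℝ (Fin d))
    (i : Fin d) :
    linProcess L t g i = ∑ q : Fin d × Fin T, (L : BlockMatrix d T) (i, t) q * g q.2 q.1 := by
  have h0 : ∀ s, s ∉ Finset.Iic t → ∀ j, (L : BlockMatrix d T) (i, t) (j, s) = 0 := by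
    intro s hs j
    exact L.2 (by simpa using hs)
  rw [Fintype.sum_prod_type_right]
  simp only [linProcess, WithLp.ofLp_sum, Finset.sum_apply]
  rw [← Finset.sum_subset (Finset.subset_univ (Finset.Iic t)) fun s _ hs =>
    Finset.sum_eq_zero fun j _ => by rw [h0 s hs j, zero_mul]]
  refine Finset.sum_congr rfl fun s _ => ?_
  simp [Matrix.toEuclideanLin, Matrix.mulVec, dotProduct, block]

/-- Pairs of paths. -/
abbrev PathPair (d T : ℕ) : Type :=
  (Fin T → EuclideanSpace ℝ (Fin d)) × (Fin T → EuclideanSpace ℝ (Fin d))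

/-- The cross-covariance matrix of a coupling of two paths. -/
noncomputable def crossCov (π : Measure (PathPair d T)) :
    BlockMatrix d T :=
  fun q r => ∫ z, z.1 q.2 q.1 * z.2 r.2 r.1 ∂π

section Coupling

variable {π : Measure (PathPair d T)}

theorem measurable_coord_mul_coord (q r : Fin d × Fin T) :
    Measurable fun g : Fin T → EuclideanSpace ℝ (Fin d) => g q.2 q.1 * g r.2 r.1 :=
  (measurable_coord q).mul (measurable_coord r)

/-- The coordinates of a pair of paths. -/
def pairCoord (r : (Fin d × Fin T) ⊕ (Fin d × Fin T))
    (z : PathPair d T) : ℝ :=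
  Sum.elim (fun q => z.1 q.2 q.1) (fun q => z.2 q.2 q.1) r

theorem memLp_pairCoord (h₁ : π.map Prod.fst = gaussianPath d T)
    (h₂ : π.map Prod.snd = gaussianPath d T) (r : (Fin d × Fin T) ⊕ (Fin d × Fin T)) :
    MemLp (pairCoord r) 2 π := by
  rcases r with q | q
  · exact (h₁ ▸ memLp_coord q).comp_of_map measurable_fst.aemeasurable
  · exact (h₂ ▸ memLp_coord q).comp_of_map measurable_snd.aemeasurable

theorem integral_sq_pairCoord (h₁ : π.map Prod.fst = gaussianPath d T)
    (h₂ : π.map Prod.snd = gaussianPath d T) (a b : Fin d × Fin T → ℝ) :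
    ∫ z, (∑ r, Sum.elim a (-b) r * pairCoord r z) ^ 2 ∂π =
      a ⬝ᵥ a + b ⬝ᵥ b - 2 * a ⬝ᵥ (crossCov π *ᵥ b) := by
  have e1 : ∀ q r : Fin d × Fin T,
      ∫ z, pairCoord (.inl q) z * pairCoord (.inl r) z ∂π = if q = r then 1 else 0 := by
    intro q r
    rw [← integral_coord_mul_coord q r, ← h₁, integral_map measurable_fst.aemeasurable
      (measurable_coord_mul_coord q r).aestronglyMeasurable]
    rfl
  have e2 : ∀ q r : Fin d × Fin T,
      ∫ z, pairCoord (.inr q) z * pairCoord (.inr r) z ∂π = if q = r then 1 else 0 := by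
    intro q r
    rw [← integral_coord_mul_coord q r, ← h₂, integral_map measurable_snd.aemeasurable
      (measurable_coord_mul_coord q r).aestronglyMeasurable]
    rfl
  have e3 : ∀ q r : Fin d × Fin T,
      ∫ z, pairCoord (.inl q) z * pairCoord (.inr r) z ∂π = crossCov π q r := fun q r => rfl
  have e4 : ∀ q r : Fin d × Fin T,
      ∫ z, pairCoord (.inr q) z * pairCoord (.inl r) z ∂π = crossCov π r q := by
    intro q r
    simp_rw [mul_comm (pairCoord (.inr q) _)]
    rfl
  rw [integral_sq_sum (memLp_pairCoord h₁ h₂)]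
  simp only [Fintype.sum_sum_type, e1, e2, e3, e4, Sum.elim_inl, Sum.elim_inr, Pi.neg_apply,
    Finset.sum_add_distrib, mul_ite, mul_one, mul_zero, Finset.sum_ite_eq, Finset.mem_univ,
    if_true, neg_mul, mul_neg, Finset.sum_neg_distrib, dotProduct, Matrix.mulVec]
  rw [Finset.sum_comm (f := fun x y => b x * a y * crossCov π y x)]
  have : ∑ i, a i * ∑ j, crossCov π i j * b j = ∑ i, ∑ j, a i * b j * crossCov π i j := by
    refine Finset.sum_congr rfl fun i _ => ?_
    rw [Finset.mul_sum]
    exact Finset.sum_congr rfl fun j _ => by ring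
  rw [this]
  simp_rw [mul_comm (b _) (a _)]
  ring

/-- Both paths have identity covariance, so expanding E(a · X - b · Y)² ≥ 0 gives exactly the
inequality defining `IsContractive`. -/
theorem isContractive_crossCov (h₁ : π.map Prod.fst = gaussianPath d T)
    (h₂ : π.map Prod.snd = gaussianPath d T) : IsContractive (crossCov π) := by
  intro a b
  have h := integral_sq_pairCoord h₁ h₂ a b
  have h0 : 0 ≤ ∫ z, (∑ r, Sum.elim a (-b) r * pairCoord r z) ^ 2 ∂π :=
    integral_nonneg fun z => sq_nonneg _
  linarith

theorem isContractive_block {K : BlockMatrix d T} (hK : IsContractive K) (t : Fin T) :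
    IsContractive (block K t t) := by
  intro a b
  have h := hK (fun q => if q.2 = t then a q.1 else 0) (fun q => if q.2 = t then b q.1 else 0)
  simpa [dotProduct, Matrix.mulVec, Fintype.sum_prod_type, block] using h

/-- Each coordinate of LX - MY is a linear form in the path coordinates, with coefficients a row of
L and minus a row of M; its second moment is `integral_sq_pairCoord`, and the sum over rows is a
trace. -/
theorem lintegral_cost (h₁ : π.map Prod.fst = gaussianPath d T)
    (h₂ : π.map Prod.snd = gaussianPath d T) (L M : BL d T) :
    ∫⁻ z, ∑ t, ‖(linProcess L t z.1 - linProcess M t z.2)‖ₑ ^ 2 ∂π =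
      ENNReal.ofReal (frob L ^ 2 + frob M ^ 2 -
        2 * ((L : BlockMatrix d T)ᵀ * ((M : BlockMatrix d T) * (crossCov π)ᵀ)).trace) := by
  have hmem := memLp_pairCoord h₁ h₂
  let F : (Fin d × Fin T) → PathPair d T → ℝ := fun p z =>
    ∑ r, Sum.elim ((L : BlockMatrix d T) p) (-(M : BlockMatrix d T) p) r * pairCoord r z
  have hF : ∀ p, Integrable (fun z => F p z ^ 2) π := fun p =>
    (memLp_finsetSum _ fun r _ => (hmem r).const_mul _).integrable_sq
  have hpt : ∀ z : PathPair d T,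
      ∑ t, ‖(linProcess L t z.1 - linProcess M t z.2)‖ₑ ^ 2 =
        ENNReal.ofReal (∑ p, F p z ^ 2) := by
    intro z
    rw [Fintype.sum_prod_type_right, ENNReal.ofReal_sum_of_nonneg
      fun t _ => Finset.sum_nonneg fun i _ => sq_nonneg _]
    refine Finset.sum_congr rfl fun t _ => ?_
    rw [← ofReal_norm, ← ENNReal.ofReal_pow (norm_nonneg _),
      EuclideanSpace.real_norm_sq_eq]
    congr 1
    refine Finset.sum_congr rfl fun i _ => ?_
    simp [F, linProcess_apply, pairCoord, Fintype.sum_sum_type, sub_eq_add_neg]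
  simp_rw [hpt]
  rw [← ofReal_integral_eq_lintegral_ofReal (integrable_finsetSum _ fun p _ => hF p)
    (ae_of_all _ fun z => Finset.sum_nonneg fun p _ => sq_nonneg _),
    integral_finsetSum _ fun p _ => hF p]
  congr 1
  simp only [F, integral_sq_pairCoord h₁ h₂, Finset.sum_sub_distrib, Finset.sum_add_distrib,
    ← Finset.mul_sum, frob_sq]
  have e : ∀ A B : BlockMatrix d T, (Aᵀ * B).trace = ∑ p, A p ⬝ᵥ B p := by
    intro A B
    simp only [Matrix.trace, Matrix.diag, Matrix.mul_apply, Matrix.transpose_apply, dotProduct]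
    exact Finset.sum_comm
  rw [e, e, e]
  congr 2
  refine Finset.sum_congr rfl fun p _ => ?_
  congr 1
  ext q
  simp [Matrix.mul_apply, Matrix.mulVec, dotProduct, mul_comm]

end Coupling

/-! ### Bicausal couplings of Gaussian paths. -/

/-- Bicausality of a coupling of two standard Gaussian paths. -/
structure IsPathBicausal (π : ProbabilityMeasure (PathPair d T)) : Prop where
  fst_eq : (π : Measure (PathPair d T)).map Prod.fst = gaussianPath d T
  snd_eq : (π : Measure (PathPair d T)).map Prod.snd = gaussianPath d T
  causal : ∀ t : Fin T,
    CondIndep ((pathFiltration d T t).comap Prod.fst) ((⨆ t, pathFiltration d T t).comap Prod.fst)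
      ((pathFiltration d T t).comap Prod.snd)
      ((MeasurableSpace.comap_mono ((pathFiltration d T).le t)).trans measurable_fst.comap_le)
      (π : Measure (PathPair d T))
  anticausal : ∀ t : Fin T,
    CondIndep ((pathFiltration d T t).comap Prod.snd) ((⨆ t, pathFiltration d T t).comap Prod.snd)
      ((pathFiltration d T t).comap Prod.fst)
      ((MeasurableSpace.comap_mono ((pathFiltration d T).le t)).trans measurable_snd.comap_le)
      (π : Measure (PathPair d T))

/-- The law and filtration underlying `gaussianProcess L` do not involve L, so one set of couplings
serves all pairs. -/
theorem isBicausal_iff (L M : BL d T) (π : ProbabilityMeasure (PathPair d T)) :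
    FilteredProcess.IsBicausal (gaussianProcess L) (gaussianProcess M) π ↔ IsPathBicausal π :=
  ⟨fun h => ⟨h.fst_eq, h.snd_eq, h.causal, h.anticausal⟩,
    fun h => ⟨h.fst_eq, h.snd_eq, h.causal, h.anticausal⟩⟩

variable {π : ProbabilityMeasure (PathPair d T)}

theorem crossCov_eq_zero_of_lt (hπ : IsPathBicausal π) {q r : Fin d × Fin T} (h : q.2 < r.2) :
    crossCov (π : Measure (PathPair d T)) q r = 0 :=
  integral_coord_mul_coord_eq_zero measurable_fst measurable_snd hπ.snd_eq h _
    (hπ.anticausal q.2) q.1 r.1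
theorem crossCov_eq_zero_of_gt (hπ : IsPathBicausal π) {q r : Fin d × Fin T} (h : r.2 < q.2) :
    crossCov (π : Measure (PathPair d T)) q r = 0 := by
  rw [← integral_coord_mul_coord_eq_zero measurable_snd measurable_fst hπ.fst_eq h _
    (hπ.causal r.2) r.1 q.1]
  exact integral_congr_ae (ae_of_all _ fun z => mul_comm _ _)

theorem crossCov_transpose (hπ : IsPathBicausal π) :
    (crossCov (π : Measure (PathPair d T)))ᵀ =
      Matrix.blockDiagonal fun t => (block (crossCov (π : Measure (PathPair d T))) t t)ᵀ := by
  ext ⟨i, t⟩ ⟨j, s⟩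
  rw [Matrix.blockDiagonal_apply, Matrix.transpose_apply]
  rcases lt_trichotomy t s with h | h | h
  · rw [if_neg h.ne, crossCov_eq_zero_of_gt hπ h]
  · subst h
    simp [block]
  · rw [if_neg h.ne', crossCov_eq_zero_of_lt hπ h]

/-! ### Rotation couplings. -/

/-- Multiplication of the components of a path by orthogonal matrices. -/
noncomputable def rotatePath (o : Fin T → Matrix.orthogonalGroup (Fin d) ℝ)
    (g : Fin T → EuclideanSpace ℝ (Fin d)) (t : Fin T) : EuclideanSpace ℝ (Fin d) :=
  Matrix.toEuclideanLin (o t : Matrix (Fin d) (Fin d) ℝ) (g t)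

theorem measurable_toEuclideanLin (A : Matrix (Fin d) (Fin d) ℝ) :
    Measurable (Matrix.toEuclideanLin A) :=
  (LinearMap.continuous_of_finiteDimensional _).measurable

theorem rotatePath_inv (o : Fin T → Matrix.orthogonalGroup (Fin d) ℝ)
    (g : Fin T → EuclideanSpace ℝ (Fin d)) : rotatePath o⁻¹ (rotatePath o g) = g := by
  funext t
  have h : (((o t)⁻¹ : Matrix.orthogonalGroup (Fin d) ℝ) : Matrix (Fin d) (Fin d) ℝ) *
      (o t : Matrix (Fin d) (Fin d) ℝ) = 1 := by
    rw [← Submonoid.coe_mul, inv_mul_cancel]; rfl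
  simp only [rotatePath, Matrix.toEuclideanLin, Pi.inv_apply, Matrix.toLpLin_apply,
    Matrix.mulVec_mulVec, h, Matrix.one_mulVec]

theorem map_stdGaussian_orthogonal (o : Matrix.orthogonalGroup (Fin d) ℝ) :
    (stdGaussian (EuclideanSpace ℝ (Fin d))).map
      (Matrix.toEuclideanLin (o : Matrix (Fin d) (Fin d) ℝ)) =
        stdGaussian (EuclideanSpace ℝ (Fin d)) := by
  let f : EuclideanSpace ℝ (Fin d) →ₗᵢ[ℝ] EuclideanSpace ℝ (Fin d) :=
    { toLinearMap := Matrix.toEuclideanLin (o : Matrix (Fin d) (Fin d) ℝ)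
      norm_map' := by
        intro x
        have hO : (o : Matrix (Fin d) (Fin d) ℝ)ᵀ * o = 1 :=
          (Matrix.mem_orthogonalGroup_iff' _ ℝ).1 o.2
        have h : ((o : Matrix (Fin d) (Fin d) ℝ) *ᵥ x.ofLp) ⬝ᵥ
            ((o : Matrix (Fin d) (Fin d) ℝ) *ᵥ x.ofLp) = x.ofLp ⬝ᵥ x.ofLp := by
          rw [Matrix.dotProduct_mulVec, Matrix.vecMul_mulVec, ← Matrix.dotProduct_mulVec,
            hO, Matrix.one_mulVec]
        rw [← sq_eq_sq₀ (norm_nonneg _) (norm_nonneg _), EuclideanSpace.real_norm_sq_eq,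
          EuclideanSpace.real_norm_sq_eq]
        simpa [dotProduct, ← sq, Matrix.toEuclideanLin] using h }
  exact stdGaussian_map (f.toLinearIsometryEquiv rfl)

theorem measurable_rotatePath (o : Fin T → Matrix.orthogonalGroup (Fin d) ℝ) :
    Measurable (rotatePath o) :=
  measurable_pi_lambda _ fun t => (measurable_toEuclideanLin _).comp (measurable_pi_apply t)

theorem map_rotatePath (o : Fin T → Matrix.orthogonalGroup (Fin d) ℝ) :
    (gaussianPath d T).map (rotatePath o) = gaussianPath d T := by
  have h := Measure.pi_map_pi (μ := fun _ : Fin T => stdGaussian (EuclideanSpace ℝ (Fin d)))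
    (f := fun t => Matrix.toEuclideanLin (o t : Matrix (Fin d) (Fin d) ℝ))
    (hμ := fun t => by rw [map_stdGaussian_orthogonal]; infer_instance)
    fun t => (measurable_toEuclideanLin _).aemeasurable
  simp only [map_stdGaussian_orthogonal] at h
  exact h

theorem rotatePath_preimage (o : Fin T → Matrix.orthogonalGroup (Fin d) ℝ) (t : Fin T)
    {B : Set (Fin T → EuclideanSpace ℝ (Fin d))} (hB : MeasurableSet[pathFiltration d T t] B) :
    MeasurableSet[pathFiltration d T t] (rotatePath o ⁻¹' B) := by
  have h : pathFiltration d T t ≤ (pathFiltration d T t).map (rotatePath o) := by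
    rw [pathFiltration_apply]
    refine iSup₂_le fun s hs => ?_
    rintro _ ⟨A, hA, rfl⟩
    exact le_iSup₂_of_le (f := fun r (_ : r ∈ Set.Iic t) => MeasurableSpace.comap
      (fun g : Fin T → EuclideanSpace ℝ (Fin d) => g r) inferInstance) s hs le_rfl _
      ⟨_, measurable_toEuclideanLin (o s : Matrix (Fin d) (Fin d) ℝ) hA, rfl⟩
  exact h B hB

/-- The law of a standard Gaussian path together with its rotation. -/
noncomputable def rotationCoupling (o : Fin T → Matrix.orthogonalGroup (Fin d) ℝ) :
    ProbabilityMeasure (PathPair d T) :=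
  ⟨(gaussianPath d T).map fun g => (g, rotatePath o g),
    Measure.isProbabilityMeasure_map
      (measurable_id.prodMk (measurable_rotatePath o)).aemeasurable⟩

theorem coe_rotationCoupling (o : Fin T → Matrix.orthogonalGroup (Fin d) ℝ) :
    (rotationCoupling o : Measure (PathPair d T)) =
      (gaussianPath d T).map fun g => (g, rotatePath o g) := rfl

theorem measurable_prodMk_rotatePath (o : Fin T → Matrix.orthogonalGroup (Fin d) ℝ) :
    Measurable fun g => (g, rotatePath o g) :=
  measurable_id.prodMk (measurable_rotatePath o)

theorem rotationCoupling_fst (o : Fin T → Matrix.orthogonalGroup (Fin d) ℝ) :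
    (rotationCoupling o : Measure (PathPair d T)).map Prod.fst = gaussianPath d T := by
  rw [coe_rotationCoupling, Measure.map_map measurable_fst (measurable_prodMk_rotatePath o)]
  exact Measure.map_id

theorem rotationCoupling_snd (o : Fin T → Matrix.orthogonalGroup (Fin d) ℝ) :
    (rotationCoupling o : Measure (PathPair d T)).map Prod.snd = gaussianPath d T := by
  rw [coe_rotationCoupling, Measure.map_map measurable_snd (measurable_prodMk_rotatePath o)]
  exact map_rotatePath o

theorem ae_eq_rotationCoupling (o : Fin T → Matrix.orthogonalGroup (Fin d) ℝ)
    {B C : Set (PathPair d T)}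
    (hB : MeasurableSet B) (hC : MeasurableSet C)
    (h : ∀ g, (g, rotatePath o g) ∈ B ↔ (g, rotatePath o g) ∈ C) :
    B =ᵐ[(rotationCoupling o : Measure (PathPair d T))] C := by
  rw [Filter.eventuallyEq_set, coe_rotationCoupling,
    ae_map_iff (measurable_prodMk_rotatePath o).aemeasurable (by measurability)]
  exact ae_of_all _ h

/-- Each component of either path is a function of the same component of the other, so at every time
the two pasts agree up to null sets. -/
theorem isPathBicausal_rotationCoupling (o : Fin T → Matrix.orthogonalGroup (Fin d) ℝ) :
    IsPathBicausal (rotationCoupling o) where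
  fst_eq := rotationCoupling_fst o
  snd_eq := rotationCoupling_snd o
  causal t := by
    have hle : ∀ t, pathFiltration d T t ≤ MeasurableSpace.pi := (pathFiltration d T).le
    refine condIndep_of_forall_ae_eq _
      ((MeasurableSpace.comap_mono (iSup_le hle)).trans measurable_fst.comap_le)
      ((MeasurableSpace.comap_mono (hle t)).trans measurable_snd.comap_le) ?_
    rintro _ ⟨B, hB, rfl⟩
    have hB' := rotatePath_preimage o t hB
    exact ⟨_, ⟨_, hB', rfl⟩, ae_eq_rotationCoupling o (measurable_snd (hle t _ hB))
      (measurable_fst (hle t _ hB')) fun g => Iff.rfl⟩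
  anticausal t := by
    have hle : ∀ t, pathFiltration d T t ≤ MeasurableSpace.pi := (pathFiltration d T).le
    refine condIndep_of_forall_ae_eq _
      ((MeasurableSpace.comap_mono (iSup_le hle)).trans measurable_snd.comap_le)
      ((MeasurableSpace.comap_mono (hle t)).trans measurable_fst.comap_le) ?_
    rintro _ ⟨B, hB, rfl⟩
    have hB' := rotatePath_preimage o⁻¹ t hB
    refine ⟨_, ⟨_, hB', rfl⟩, ae_eq_rotationCoupling o (measurable_fst (hle t _ hB))
      (measurable_snd (hle t _ hB')) fun g => ?_⟩
    simp only [Set.mem_preimage, rotatePath_inv]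

/-- For Y = OX the matrix E[XYᵀ] is Oᵀ, hence the transpose here and in the cost formula. -/
theorem crossCov_rotationCoupling (o : Fin T → Matrix.orthogonalGroup (Fin d) ℝ) :
    (crossCov (rotationCoupling o : Measure (PathPair d T)))ᵀ = (orthDiag o : BlockMatrix d T) := by
  ext ⟨i, t⟩ ⟨j, s⟩
  rw [coe_orthDiag, Matrix.blockDiagonal_apply, Matrix.transpose_apply, crossCov,
    coe_rotationCoupling, integral_map (measurable_prodMk_rotatePath o).aemeasurable]
  · have h : ∀ g : Fin T → EuclideanSpace ℝ (Fin d), g s j * rotatePath o g t i =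
        ∑ k, (o t : Matrix (Fin d) (Fin d) ℝ) i k * (g s j * g t k) := by
      intro g
      simp only [rotatePath, Matrix.toEuclideanLin, Matrix.toLpLin_apply, Matrix.mulVec,
        dotProduct, Finset.mul_sum]
      exact Finset.sum_congr rfl fun k _ => by ring
    simp only [h]
    have hint : ∀ k, Integrable
        (fun g : Fin T → EuclideanSpace ℝ (Fin d) => g s j * g t k) (gaussianPath d T) :=
      fun k => (memLp_coord (j, s)).integrable_mul (memLp_coord (k, t))
    rw [integral_finsetSum _ fun k _ => (hint k).const_mul _]
    have h2 : ∀ k, ∫ g : Fin T → EuclideanSpace ℝ (Fin d), g s j * g t k ∂gaussianPath d T =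
        if (j, s) = (k, t) then 1 else 0 := fun k => integral_coord_mul_coord (j, s) (k, t)
    simp only [integral_const_mul, h2, Prod.mk.injEq]
    by_cases hts : t = s
    · simp [hts]
    · simp [hts, Ne.symm hts]
  · exact (((measurable_coord (j, s)).comp measurable_fst).mul
      ((measurable_coord (i, t)).comp measurable_snd)).aestronglyMeasurable

/-! ### The distance as a minimum over rotations. -/

theorem cost_eq (L M : BL d T) {π : ProbabilityMeasure (PathPair d T)} (hπ : IsPathBicausal π) :
    FilteredProcess.cost (gaussianProcess L) (gaussianProcess M) π =
      ENNReal.ofReal (frob L ^ 2 + frob M ^ 2 - 2 * ((L : BlockMatrix d T)ᵀ *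
        ((M : BlockMatrix d T) * (crossCov (π : Measure (PathPair d T)))ᵀ)).trace) :=
  lintegral_cost hπ.fst_eq hπ.snd_eq L M

theorem exists_mem_Ostar_dABW_eq (L M : BL d T) :
    ∃ P ∈ Ostar L M, dABW L M = frob (L - M * P) := by
  obtain ⟨P, hP, hopt⟩ := exists_optimal L M
  refine ⟨P, mem_Ostar_of_optimal hP hopt, ?_⟩
  have hsq : frob (L - M * P) ^ 2 = frob L ^ 2 + frob M ^ 2 -
      2 * ((L : BlockMatrix d T)ᵀ * ((M * P : BL d T) : BlockMatrix d T)).trace := by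
    rw [frob_sub_sq, frob_mul_of_mem_bO _ hP]
  have hinf : (⨅ (π : ProbabilityMeasure ((gaussianProcess L).Ω × (gaussianProcess M).Ω))
      (_ : FilteredProcess.IsBicausal (gaussianProcess L) (gaussianProcess M) π),
      FilteredProcess.cost (gaussianProcess L) (gaussianProcess M) π) =
        ENNReal.ofReal (frob (L - M * P) ^ 2) := by
    refine le_antisymm ?_ (le_iInf₂ fun π hπ => ?_)
    · obtain ⟨o, rfl⟩ := hP
      have h := cost_eq L M (isPathBicausal_rotationCoupling o)
      rw [crossCov_rotationCoupling, ← Subalgebra.coe_mul, ← hsq] at h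
      rw [← h]
      exact iInf₂_le (rotationCoupling o)
        ((isBicausal_iff L M _).2 (isPathBicausal_rotationCoupling o))
    · have hπ' := (isBicausal_iff L M π).1 hπ
      refine le_trans ?_ (cost_eq L M hπ').ge
      refine ENNReal.ofReal_le_ofReal ?_
      -- The optimal rotation beats all block-diagonal contractions, in particular the
      -- cross-covariance of an arbitrary bicausal coupling.
      have := hopt _ fun t =>
        isContractive_block (isContractive_crossCov hπ'.fst_eq hπ'.snd_eq) t
      rw [hsq, crossCov_transpose hπ']
      linarith
  rw [dABW, FilteredProcess.adaptedW2, hinf, ← ENNReal.toReal_rpow,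
    ENNReal.toReal_ofReal (sq_nonneg _), ← Real.sqrt_eq_rpow, Real.sqrt_sq (frob_nonneg _)]

/-! ### The quotient metric. -/

theorem cls_eq_iff {L M : BL d T} : cls L = cls M ↔ ∃ O ∈ bO d T, L = M * O := Quotient.eq

theorem cls_mul {L O : BL d T} (hO : O ∈ bO d T) : cls (L * O) = cls L :=
  cls_eq_iff.2 ⟨O, hO, rfl⟩

theorem dABW_eq {L M P : BL d T} (hP : P ∈ Ostar L M) : dABW L M = frob (L - M * P) := by
  obtain ⟨Q, hQ, h⟩ := exists_mem_Ostar_dABW_eq L M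
  rw [h]
  exact le_antisymm (hQ.2 P hP.1) (hP.2 Q hQ.1)

theorem dABW_le {L M O : BL d T} (hO : O ∈ bO d T) : dABW L M ≤ frob (L - M * O) := by
  obtain ⟨Q, hQ, h⟩ := exists_mem_Ostar_dABW_eq L M
  rw [h]
  exact hQ.2 O hO

theorem dABW_le_of_cls_eq {A B L M : BL d T} (hA : cls A = cls L) (hB : cls B = cls M) :
    dABW A B ≤ dABW L M := by
  obtain ⟨O, hO, rfl⟩ := cls_eq_iff.1 hA
  obtain ⟨Q, hQ, rfl⟩ := cls_eq_iff.1 hB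
  obtain ⟨P, hP, h⟩ := exists_mem_Ostar_dABW_eq L M
  obtain ⟨R, hR, hQR⟩ := exists_inv_bO hQ
  rw [h, ← frob_mul_of_mem_bO _ hO]
  -- With A = LO, B = MQ and R = Q⁻¹, the competitor RPO turns the difference into (L - MP)O.
  refine (dABW_le (mul_mem_bO hR (mul_mem_bO hP.1 hO))).trans_eq ?_
  congr 1
  rw [sub_mul, ← mul_assoc, mul_assoc M Q R, hQR, mul_one, mul_assoc]

theorem qdist_cls (L M : BL d T) : qdist (cls L) (cls M) = dABW L M := by
  have : {r : ℝ | ∃ A B : BL d T, cls A = cls L ∧ cls B = cls M ∧ dABW A B = r} =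
      {dABW L M} := by
    ext r
    simp only [Set.mem_ofPred_eq, Set.mem_singleton_iff]
    constructor
    · rintro ⟨A, B, hA, hB, rfl⟩
      exact le_antisymm (dABW_le_of_cls_eq hA hB) (dABW_le_of_cls_eq hA.symm hB.symm)
    · rintro rfl
      exact ⟨L, M, rfl, rfl, rfl⟩
  rw [qdist, this, csInf_singleton]

theorem qdist_le_frob (L M : BL d T) : qdist (cls L) (cls M) ≤ frob (L - M) := by
  rw [qdist_cls]
  simpa using dABW_le (L := L) (M := M) one_mem_bO

/-- The distance is attained with the first representative prescribed, so points of the quotient can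
be lifted one after another. -/
theorem exists_rep_right (L : BL d T) (y : ABWSpace d T) :
    ∃ N, cls N = y ∧ frob (L - N) = qdist (cls L) y := by
  obtain ⟨M, rfl⟩ : ∃ M, cls M = y := Quotient.exists_rep y
  obtain ⟨P, hP, h⟩ := exists_mem_Ostar_dABW_eq L M
  exact ⟨M * P, cls_mul hP.1, by rw [qdist_cls, h]⟩

theorem qdist_nonneg (x y : ABWSpace d T) : 0 ≤ qdist x y := by
  obtain ⟨L, rfl⟩ : ∃ L, cls L = x := Quotient.exists_rep x
  obtain ⟨N, -, h⟩ := exists_rep_right L y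
  exact h ▸ frob_nonneg _

theorem qdist_comm (x y : ABWSpace d T) : qdist x y = qdist y x := by
  have key : ∀ x y : ABWSpace d T, qdist x y ≤ qdist y x := by
    intro x y
    obtain ⟨M, rfl⟩ : ∃ M, cls M = y := Quotient.exists_rep y
    obtain ⟨N, rfl, h⟩ := exists_rep_right M x
    rw [← h, frob_sub_comm]
    exact qdist_le_frob N M
  exact le_antisymm (key x y) (key y x)

theorem frob_sub_le (A B C : BL d T) : frob (A - C) ≤ frob (A - B) + frob (B - C) := by
  simp only [← norm_toEuc, map_sub]
  exact norm_sub_le_norm_sub_add_norm_sub _ _ _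

theorem qdist_triangle (x y z : ABWSpace d T) : qdist x z ≤ qdist x y + qdist y z := by
  obtain ⟨L, rfl⟩ : ∃ L, cls L = x := Quotient.exists_rep x
  obtain ⟨M, rfl, h⟩ := exists_rep_right L y
  obtain ⟨N, rfl, h'⟩ := exists_rep_right M z
  rw [← h, ← h']
  exact (qdist_le_frob L N).trans (frob_sub_le L M N)

theorem frob_smul (c : ℝ) (A : BL d T) : frob (c • A) = |c| * frob A := by
  rw [← norm_toEuc, map_smul, norm_smul, norm_toEuc, Real.norm_eq_abs]

/-! ### Geodesics and their lifts. -/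

theorem mem_VSet_iff {L V : BL d T} : V ∈ VSet L ↔ qdist (cls L) (cls (L + V)) = frob V := by
  constructor
  · rintro ⟨M, P, hP, rfl⟩
    rw [add_sub_cancel, cls_mul hP.1, qdist_cls, dABW_eq hP, frob_sub_comm]
  · intro h
    refine ⟨L + V, 1, ⟨one_mem_bO, fun O hO => ?_⟩, by simp⟩
    have h1 : frob (L - (L + V) * 1) = frob V := by
      rw [mul_one, frob_sub_comm, add_sub_cancel_left]
    rw [h1, ← h, qdist_cls]
    exact dABW_le hO

/-- Equality in the triangle inequality forces collinearity. -/
theorem smul_eq_smul_of_norm_add {E : Type*} [NormedAddCommGroup E] [InnerProductSpace ℝ E]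
    {a b : E} {s r l : ℝ} (hs : 0 ≤ s) (hr : 0 ≤ r) (hl : 0 ≤ l) (ha : ‖a‖ = s * l)
    (hb : ‖b‖ = r * l) (hab : (s + r) * l ≤ ‖a + b‖) : r • a = s • b := by
  have h1 : ((s + r) * l) ^ 2 ≤ ‖a + b‖ ^ 2 := pow_le_pow_left₀ (by positivity) hab 2
  rw [norm_add_sq_real, ha, hb] at h1
  have h2 : s * r * l ^ 2 ≤ inner ℝ a b := by nlinarith
  have h3 : ‖r • a - s • b‖ ^ 2 ≤ 0 := by
    rw [norm_sub_sq_real, norm_smul, norm_smul, inner_smul_left, inner_smul_right, ha, hb,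
      Real.norm_of_nonneg hs, Real.norm_of_nonneg hr]
    simp only [conj_trivial]
    nlinarith [mul_le_mul_of_nonneg_left h2 (mul_nonneg hs hr)]
  have h4 : ‖r • a - s • b‖ = 0 := by
    have := le_antisymm h3 (sq_nonneg _)
    exact pow_eq_zero_iff two_ne_zero |>.1 this
  exact sub_eq_zero.1 (norm_eq_zero.1 h4)

/-- The quotient distance bounds ‖A - C‖ from below, so the broken line through B is already
straight. The conclusion avoids division, since s, r or l may vanish. -/
theorem smul_sub_eq_smul_sub {A B C : BL d T} {s r l : ℝ} (hs : 0 ≤ s) (hr : 0 ≤ r)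
    (hl : 0 ≤ l) (h₁ : frob (A - B) = s * l) (h₂ : frob (B - C) = r * l)
    (h : (s + r) * l ≤ qdist (cls A) (cls C)) : r • (A - B) = s • (B - C) := by
  have h' := h.trans (qdist_le_frob A C)
  rw [← norm_toEuc] at h₁ h₂ h'
  refine toEuc_injective ?_
  rw [map_smul, map_smul]
  refine smul_eq_smul_of_norm_add hs hr hl h₁ h₂ ?_
  rwa [← map_add, sub_add_sub_cancel]

/-- Projection does not increase distances, while the endpoints keep their full distance; the
triangle inequality then leaves no slack on any subinterval. -/
theorem displacement_mem_Geod {L V : BL d T} (hV : V ∈ VSet L) : displacement L V ∈ Geod L := by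
  rw [mem_VSet_iff] at hV
  have h0 : displacement L V 0 = cls L := by simp [displacement]
  have h1 : displacement L V 1 = cls (L + V) := by simp [displacement]
  have hle : ∀ u v : unitInterval, qdist (displacement L V u) (displacement L V v) ≤
      |(u : ℝ) - v| * frob V := by
    intro u v
    refine (qdist_le_frob _ _).trans_eq ?_
    rw [← frob_smul]
    congr 1
    rw [sub_smul]
    abel
  have key : ∀ u v : unitInterval, (u : ℝ) ≤ v →
      qdist (displacement L V u) (displacement L V v) = |(u : ℝ) - v| * frob V := by
    intro u v huv
    refine le_antisymm (hle u v) ?_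
    have h2 := hle 0 u
    have h3 := hle v 1
    have h4 := qdist_triangle (displacement L V 0) (displacement L V u) (displacement L V 1)
    have h5 := qdist_triangle (displacement L V u) (displacement L V v) (displacement L V 1)
    rw [h0, h1, hV] at h4
    rw [h0] at h2
    rw [h1] at h3 h5
    simp only [Set.Icc.coe_zero, zero_sub, abs_neg,
      abs_of_nonneg u.2.1] at h2
    rw [Set.Icc.coe_one, abs_sub_comm, abs_of_nonneg (sub_nonneg.2 v.2.2)] at h3
    rw [abs_sub_comm, abs_of_nonneg (sub_nonneg.2 huv)]
    linarith
  refine ⟨h0, fun u v => ?_⟩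
  rw [h0, h1, hV]
  rcases le_total (u : ℝ) v with h | h
  · exact key u v h
  · rw [qdist_comm, abs_sub_comm]
    exact key v u h

/-- Aligning each point directly with L would leave a choice of representatives. Instead the
midpoint is aligned with L, giving P, and all other points with P; the equality case then fixes
them. -/
theorem exists_displacement_eq {L : BL d T} {γ : unitInterval → ABWSpace d T}
    (hγ : γ ∈ Geod L) : ∃ V ∈ VSet L, γ = displacement L V := by
  obtain ⟨h0, hd⟩ := hγ
  set l := qdist (γ 0) (γ 1) with hl
  have hl0 : 0 ≤ l := qdist_nonneg _ _
  let m : unitInterval := ⟨1 / 2, by norm_num, by norm_num⟩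
  have hm : (m : ℝ) = 1 / 2 := rfl
  obtain ⟨P, hP, hLP⟩ := exists_rep_right L (γ m)
  obtain ⟨N, hN, hPN⟩ := exists_rep_right P (γ 1)
  rw [← h0, hd, hm, Set.Icc.coe_zero] at hLP
  rw [hP, hd, hm, Set.Icc.coe_one] at hPN
  have hLP' : frob (L - P) = 1 / 2 * l := by rw [hLP]; norm_num [abs_of_pos]
  have hPN' : frob (P - N) = 1 / 2 * l := by rw [hPN]; norm_num [abs_of_pos]
  have hmid := smul_sub_eq_smul_sub (by norm_num) (by norm_num) hl0 hLP' hPN'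
    (by rw [← h0, hN, ← hl]; norm_num)
  have hmid' : L - P = P - N := smul_right_injective _ (by norm_num : (1 / 2 : ℝ) ≠ 0) hmid
  have hPV : P - L = (1 / 2 : ℝ) • (N - L) := by
    rw [show N - L = (2 : ℝ) • (P - L) by
      rw [two_smul]; nth_rw 1 [← neg_sub L P]; rw [hmid']; abel]
    rw [smul_smul]; norm_num
  have hNP : N - P = (1 / 2 : ℝ) • (N - L) := by
    rw [← hPV, ← neg_sub P N, ← hmid', neg_sub]
  refine ⟨N - L, ?_, ?_⟩
  · rw [mem_VSet_iff, add_sub_cancel, ← h0, hN, ← hl]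
    have := frob_smul (1 / 2) (N - L)
    rw [← hPV, frob_sub_comm, hLP'] at this
    norm_num [abs_of_pos] at this
    exact this
  · funext u
    obtain ⟨Q, hQ, hPQ⟩ := exists_rep_right P (γ u)
    rw [hP, hd, hm] at hPQ
    rw [displacement, ← hQ]
    congr 1
    have hP' : P = L + (1 / 2 : ℝ) • (N - L) := by rw [← hPV]; abel
    -- Q is compared with the endpoint on the other side of P: N when u ≤ 1/2, L otherwise.
    rcases le_total (u : ℝ) (1 / 2) with hu | hu
    · rw [abs_of_nonneg (by linarith)] at hPQ
      have h := smul_sub_eq_smul_sub (A := N) (B := P) (C := Q) (s := 1 / 2)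
        (r := 1 / 2 - (u : ℝ)) (by norm_num) (by linarith) hl0 (by rw [frob_sub_comm, hPN'])
        hPQ (by
          rw [hN, hQ, hd, Set.Icc.coe_one, abs_of_nonneg (by linarith [u.2.2])]
          linarith)
      rw [hNP, smul_comm] at h
      have h' := smul_right_injective _ (by norm_num : (1 / 2 : ℝ) ≠ 0) h
      have hQ' : Q = P - (1 / 2 - (u : ℝ)) • (N - L) := by rw [h']; abel
      rw [hQ', hP']
      module
    · rw [abs_sub_comm, abs_of_nonneg (by linarith)] at hPQ
      have h := smul_sub_eq_smul_sub (A := L) (B := P) (C := Q) (s := 1 / 2)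
        (r := (u : ℝ) - 1 / 2) (by norm_num) (by linarith) hl0 hLP' hPQ (by
          rw [← h0, hQ, hd, Set.Icc.coe_zero, zero_sub, abs_neg, abs_of_nonneg u.2.1]
          linarith)
      rw [← neg_sub P L, hPV, ← smul_neg, smul_comm] at h
      have h' := smul_right_injective _ (by norm_num : (1 / 2 : ℝ) ≠ 0) h
      have hQ' : Q = P - ((u : ℝ) - 1 / 2) • -(N - L) := by rw [h']; abel
      rw [hQ', hP']
      module

/-- A rotation O matching the two midpoints extends the first half of one segment by the rotated
second half of the other. This broken line is minimizing, hence straight, so V = WO; the midpoint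
equation then gives LO = L. -/
theorem exists_of_displacement_eq {L V W : BL d T} (hV : V ∈ VSet L) (hW : W ∈ VSet L)
    (h : displacement L V = displacement L W) : ∃ O ∈ Ostar L L, V = W * O := by
  rw [mem_VSet_iff] at hV hW
  have h1 : cls (L + V) = cls (L + W) := by
    have := congrFun h 1
    simpa [displacement] using this
  have hVW : frob V = frob W := by rw [← hV, ← hW, h1]
  have hm := congrFun h ⟨1 / 2, by norm_num, by norm_num⟩
  obtain ⟨O, hO, hLO⟩ := cls_eq_iff.1 hm
  simp only at hLO
  rw [add_mul, smul_mul_assoc] at hLO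
  have hN : cls (L * O + W * O) = cls (L + V) := by rw [← add_mul, cls_mul hO, h1]
  have e1 : L - (L + (1 / 2 : ℝ) • V) = -(1 / 2 : ℝ) • V := by module
  have e2 : (L + (1 / 2 : ℝ) • V) - (L * O + W * O) = -(1 / 2 : ℝ) • (W * O) := by
    rw [hLO]; module
  have hmid := smul_sub_eq_smul_sub (A := L) (B := L + (1 / 2 : ℝ) • V) (C := L * O + W * O)
    (s := 1 / 2) (r := 1 / 2) (l := frob V) (by norm_num) (by norm_num) (frob_nonneg V)
    (by rw [e1, frob_smul]; norm_num [abs_of_pos])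
    (by rw [e2, frob_smul, frob_mul_of_mem_bO _ hO, hVW]; norm_num [abs_of_pos])
    (by rw [hN, hV]; norm_num)
  rw [e1, e2, smul_smul, smul_smul] at hmid
  have hVO : V = W * O := smul_right_injective _ (by norm_num : (1 / 2 * -(1 / 2) : ℝ) ≠ 0) hmid
  refine ⟨O, mem_Ostar_self.2 ⟨hO, ?_⟩, hVO⟩
  rw [← hVO] at hLO
  exact (add_right_cancel hLO).symm

theorem displacement_eq_of_rel {L V W : BL d T} (h : ∃ O ∈ Ostar L L, V = W * O) :
    displacement L V = displacement L W := by
  obtain ⟨O, hO, rfl⟩ := h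
  rw [mem_Ostar_self] at hO
  funext u
  refine cls_eq_iff.2 ⟨O, hO.1, ?_⟩
  rw [add_mul, hO.2, smul_mul_assoc]

/-- Since LO = L, each diagonal block of LᵀL is unchanged by right multiplication with the
corresponding block of O; being invertible, it cancels. -/
theorem eq_one_of_isReg {L O : BL d T} (hL : IsReg L) (hO : O ∈ Ostar L L) : O = 1 := by
  obtain ⟨⟨o, rfl⟩, h⟩ := mem_Ostar_self.1 hO
  have h1 : ((L : BlockMatrix d T)ᵀ * (L : BlockMatrix d T)) * (orthDiag o : BlockMatrix d T) =
      (L : BlockMatrix d T)ᵀ * (L : BlockMatrix d T) := by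
    rw [Matrix.mul_assoc, ← Subalgebra.coe_mul, h]
  have h2 : ∀ t, (o t : Matrix (Fin d) (Fin d) ℝ) = 1 := by
    intro t
    have h3 : block ((L : BlockMatrix d T)ᵀ * (L : BlockMatrix d T)) t t *
        (o t : Matrix (Fin d) (Fin d) ℝ) =
          block ((L : BlockMatrix d T)ᵀ * (L : BlockMatrix d T)) t t := by
      ext i j
      have := congrFun (congrFun h1 (i, t)) (j, t)
      rw [Matrix.mul_apply, Fintype.sum_prod_type_right,
        Finset.sum_eq_single t (by simp +contextual [coe_orthDiag, Matrix.blockDiagonal_apply])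
          (by simp)] at this
      simpa [Matrix.mul_apply, block, coe_orthDiag, Matrix.blockDiagonal_apply] using this
    have hu := (hL t).isUnit
    exact hu.mul_left_cancel (by rw [h3, Matrix.mul_one])
  have h3 : o = 1 := funext fun t => Subtype.ext (h2 t)
  rw [h3]
  exact Subtype.ext (Matrix.blockDiagonal_one (m := Fin d) (o := Fin T) (α := ℝ))

/-- The displacement interpolation on the quotient of directions. -/
noncomputable def displacementMap (L : BL d T) : VQuot L → Geod L :=
  Quotient.lift (fun V : VSet L => ⟨displacement L V, displacement_mem_Geod V.2⟩)
    fun _ _ h => Subtype.ext (displacement_eq_of_rel h)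

theorem displacementMap_bijective (L : BL d T) : Function.Bijective (displacementMap L) := by
  constructor
  · intro x y
    induction x using Quotient.inductionOn with | _ V
    induction y using Quotient.inductionOn with | _ W
    intro h
    exact Quotient.sound (exists_of_displacement_eq V.2 W.2 (congrArg Subtype.val h))
  · rintro ⟨γ, hγ⟩
    obtain ⟨V, hV, rfl⟩ := exists_displacement_eq hγ
    exact ⟨Quotient.mk _ ⟨V, hV⟩, rfl⟩

end ABW

theorem theorem3p8 (d T : ℕ) (L : ABW.BL d T) :
    (∃ Φ : ABW.VQuot L ≃ ABW.Geod L,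
      ∀ V : ABW.VSet L,
        (Φ (Quotient.mk (ABW.VSetoid L) V) : unitInterval → ABW.ABWSpace d T) =
          ABW.displacement L V) ∧
    (∀ γ ∈ ABW.Geod L, ∃ V ∈ ABW.VSet L, ∀ u : unitInterval, γ u = ABW.displacement L V u) ∧
    (ABW.IsReg L → ∀ γ ∈ ABW.Geod L,
      ∃! V : ABW.BL d T, V ∈ ABW.VSet L ∧ ∀ u : unitInterval, γ u = ABW.displacement L V u) := by
  refine ⟨⟨Equiv.ofBijective _ (ABW.displacementMap_bijective L), fun V => rfl⟩,
    fun γ hγ => ?_, fun hL γ hγ => ?_⟩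
  · obtain ⟨V, hV, rfl⟩ := ABW.exists_displacement_eq hγ
    exact ⟨V, hV, fun u => rfl⟩
  · obtain ⟨V, hV, rfl⟩ := ABW.exists_displacement_eq hγ
    refine ⟨V, ⟨hV, fun u => rfl⟩, fun W hW => ?_⟩
    obtain ⟨O, hO, h⟩ := ABW.exists_of_displacement_eq hW.1 hV (funext fun u => (hW.2 u).symm)
    rw [h, ABW.eq_one_of_isReg hL hO, mul_one]
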